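/- **Theorem 3.5.** Let $d\in\mathbb N$ and let $X\subset\mathbb R^d$ be a countable, relatively separated set, i.e. $\sup_{x\in\mathbb R^d}|X\cap(x+[0,1]^d)|<\infty$. Let $\mathcal H$ be a complex Hilbert space, let $0<p\le 1$ and $0<\delta\le 1$, and let $\nu_\delta(x)=(1+|x|)^\delta$ for $x\in\mathbb R^d$, where $|\cdot|$ is the Euclidean norm. For a weight $\nu:\mathbb R^d\to[0,\infty)$ let $\mathcal S^p_\nu=\mathcal S^p_\nu(X)$ be the set of all matrices $A=[A_{k,l}]_{k,l\in X}$ with entries in $B(\mathcal H)$ such that $$\|A\|_{\mathcal S^p_\nu}=\max\Big\{\sup_{k\in X}\sum_{l\in X}\|A_{k,l}\|^p\nu(k-l)^p,\ \sup_{l\in X}\sum_{k\in X}\|A_{k,l}\|^p\nu(k-l)^p\Big\}<\infty ,$$ with matrix multiplication and the involution $A^*=[(A_{l,k})^*]_{k,l\in X}$, and let $\mathcal S^p=\mathcal S^p_1$ be the unweighted case $\nu\equiv1$. For $A\in\mathcal S^p_\nu$ let $$r_{\mathcal S^p_\nu}(A)=\sup\{|\lambda|^p:\lambda\in\mathbb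 C,\ \lambda I-A\text{ has no two-sided inverse in }\mathcal S^p_\nu\},$$ and let $r_{B(\ell^2(X,\mathcal H))}(T)=\sup\{|\lambda|:\lambda\in\sigma(T)\}$ be the usual spectral radius of a bounded operator $T$ on $\ell^2(X,\mathcal H)$ (suprema are taken in $[0,\infty]$, with $\sup\emptyset=0$). Then every $A=A^*\in\mathcal S^p_{\nu_\delta}$ defines a bounded operator on $\ell^2(X,\mathcal H)$, again denoted by $A$, through $(Ax)_k=\sum_{l\in X}A_{k,l}x_l$ (convergent series), and $$r_{\mathcal S^p_{\nu_\delta}}(A)=r_{\mathcal S^p}(A)=r_{B(\ell^2(X,\mathcal H))}(A)^p .$$ -/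

import Mathlib

open scoped ENNReal

namespace SchurAlg

/-- A countable set `X ⊆ ℝ^d` is relatively separated if the numbers of points of `X` in the
translated unit cubes `x + [0,1]^d` are bounded uniformly in `x ∈ ℝ^d`. -/
def IsRelativelySeparated {d : ℕ} (X : Set (EuclideanSpace ℝ (Fin d))) : Prop :=
  X.Countable ∧ ∃ N : ℕ, ∀ x : EuclideanSpace ℝ (Fin d),
    (X ∩ {y | ∀ i, x i ≤ y i ∧ y i ≤ x i + 1}).encard ≤ N

/-- The polynomial weight `ν_δ(x) = (1 + |x|)^δ`, with `|x|` the Euclidean norm. -/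
noncomputable def polyWeight {d : ℕ} (δ : ℝ) (x : EuclideanSpace ℝ (Fin d)) : ℝ :=
  (1 + ‖x‖) ^ δ

section Matrices

variable {d : ℕ} {X : Set (EuclideanSpace ℝ (Fin d))}
  {H : Type*} [NormedAddCommGroup H] [InnerProductSpace ℂ H]

/-- The `p`-norm `‖A‖_{S^p_ν}`, `0 < p ≤ 1`, of a `B(H)`-valued matrix over `X`,
with value `∞` allowed:
the larger of `sup_k ∑_l ‖A_{k,l}‖^p ν(k-l)^p` and `sup_l ∑_k ‖A_{k,l}‖^p ν(k-l)^p`. -/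
noncomputable def schurNorm (p : ℝ) (ν : EuclideanSpace ℝ (Fin d) → ℝ)
    (A : Matrix X X (H →L[ℂ] H)) : ℝ≥0∞ :=
  max (⨆ k : X, ∑' l : X, ENNReal.ofReal (‖A k l‖ ^ p * ν (k - l) ^ p))
    (⨆ l : X, ∑' k : X, ENNReal.ofReal (‖A k l‖ ^ p * ν (k - l) ^ p))

/-- The Schur-type algebra `S^p_ν(X)`, `0 < p ≤ 1`, as a set of `B(H)`-valued matrices. -/
def schurClass (X : Set (EuclideanSpace ℝ (Fin d))) (H : Type*) [NormedAddCommGroup H]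
    [InnerProductSpace ℂ H] (p : ℝ) (ν : EuclideanSpace ℝ (Fin d) → ℝ) :
    Set (Matrix X X (H →L[ℂ] H)) :=
  {A | schurNorm p ν A < ∞}

/-- The product of two (possibly infinite) `B(H)`-valued matrices over `X`. If both factors lie in
`S^p_ν`, where `0 < p ≤ 1` and `ν ≥ 1`, then all these series converge absolutely in `B(H)`. -/
noncomputable def matMul (A B : Matrix X X (H →L[ℂ] H)) : Matrix X X (H →L[ℂ] H) :=
  Matrix.of fun k l => ∑' m : X, A k m * B m l

open Classical in
/-- The spectrum of `A` in `S^p_ν(X)`: the `z ∈ ℂ` such that `z I - A` has no two-sided inverse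
in `S^p_ν(X)` for the matrix product. -/
def schurSpectrum (p : ℝ) (ν : EuclideanSpace ℝ (Fin d) → ℝ)
    (A : Matrix X X (H →L[ℂ] H)) : Set ℂ :=
  {z | ¬ ∃ B ∈ schurClass X H p ν, matMul (z • 1 - A) B = 1 ∧ matMul B (z • 1 - A) = 1}

/-- The spectral radius in the `p`-Banach algebra `S^p_ν(X)`: the supremum of `|z|^p` over the
spectrum (in `[0,∞]`, so that nothing is presupposed about boundedness). -/
noncomputable def schurRadius (p : ℝ) (ν : EuclideanSpace ℝ (Fin d) → ℝ)
    (A : Matrix X X (H →L[ℂ] H)) : ℝ≥0∞ :=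
  ⨆ z ∈ schurSpectrum p ν A, ENNReal.ofReal (‖z‖ ^ p)

/-- The bounded operator `T` on `ℓ²(X, H)` is given by the matrix `A`:
`(T x)_k = ∑_l A_{k,l} x_l`, with convergent series. -/
def IsOperatorOf (T : lp (fun _ : X => H) 2 →L[ℂ] lp (fun _ : X => H) 2)
    (A : Matrix X X (H →L[ℂ] H)) : Prop :=
  ∀ (x : lp (fun _ : X => H) 2) (k : X), HasSum (fun l : X => A k l (x l)) (T x k)

end Matrices

end SchurAlg

/-! For `p ≤ 1` the class `S^p` embeds in `S^1`, so Schur's test makes its matrices bounded on `ℓ²`.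
An inverse in the smaller class is an inverse in the larger one, so spectra shrink from `S^p_ν` to
`S^p` to `B(ℓ²)`, and the radii are ordered accordingly. The circle closes because a self-adjoint
`T` has spectral radius `‖T‖`: it suffices to invert `z - T` in `S^p_ν` when `‖T‖ < |z|`. The
Neumann series does this once the powers of a contraction are summable in the weighted norm, which
is Brandenburg's trick (`tsum_opSchurNorm_pow_ne_top`). Let `a n` and `b n` be the weighted and
unweighted norms of `T ^ n`. Subadditivity of `ν_δ ^ p` gives `a (2 * n) ≤ 2 * a n * b n`
(`opSchurNorm_mul_le`). Cutting the matrix at distance `m` bounds `b n` by about `m ^ d * ‖T‖ ^ (p *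
n) + m ^ (-ε) * a n`, with `ε = δ * p`. Letting `m` grow slowly like `t ^ n` yields `b n ≤ C * w ^ n
* (1 + a n)` with `w < 1`, and this doubling recursion forces geometric decay
(`summable_of_doubling`). -/

namespace SchurAlg

/-! ### Row and column sums of nonnegative kernels. -/

section Kernel

variable {ι : Type*}

/-- The larger of the suprema of the row sums and of the column sums of a kernel. -/
noncomputable def kernelNorm (f : ι → ι → ℝ≥0∞) : ℝ≥0∞ :=
  max (⨆ k, ∑' l, f k l) (⨆ l, ∑' k, f k l)

lemma row_le_kernelNorm (f : ι → ι → ℝ≥0∞) (k : ι) : ∑' l, f k l ≤ kernelNorm f :=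
  (le_iSup (fun k => ∑' l, f k l) k).trans (le_max_left _ _)

lemma col_le_kernelNorm (f : ι → ι → ℝ≥0∞) (l : ι) : ∑' k, f k l ≤ kernelNorm f :=
  (le_iSup (fun l => ∑' k, f k l) l).trans (le_max_right _ _)

lemma kernelNorm_le {f : ι → ι → ℝ≥0∞} {C : ℝ≥0∞} (hrow : ∀ k, ∑' l, f k l ≤ C)
    (hcol : ∀ l, ∑' k, f k l ≤ C) : kernelNorm f ≤ C :=
  max_le (iSup_le hrow) (iSup_le hcol)

lemma kernelNorm_mono {f g : ι → ι → ℝ≥0∞} (h : ∀ k l, f k l ≤ g k l) :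
    kernelNorm f ≤ kernelNorm g :=
  kernelNorm_le (fun k => (ENNReal.tsum_le_tsum (h k)).trans (row_le_kernelNorm g k))
    (fun l => (ENNReal.tsum_le_tsum fun k => h k l).trans (col_le_kernelNorm g l))

lemma kernelNorm_add_le (f g : ι → ι → ℝ≥0∞) :
    kernelNorm (fun k l => f k l + g k l) ≤ kernelNorm f + kernelNorm g := by
  refine kernelNorm_le (fun k => ?_) (fun l => ?_) <;> rw [ENNReal.tsum_add]
  · exact add_le_add (row_le_kernelNorm f k) (row_le_kernelNorm g k)
  · exact add_le_add (col_le_kernelNorm f l) (col_le_kernelNorm g l)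

lemma kernelNorm_const_mul (c : ℝ≥0∞) (f : ι → ι → ℝ≥0∞) :
    kernelNorm (fun k l => c * f k l) ≤ c * kernelNorm f := by
  refine kernelNorm_le (fun k => ?_) (fun l => ?_) <;> rw [ENNReal.tsum_mul_left]
  · gcongr; exact row_le_kernelNorm f k
  · gcongr; exact col_le_kernelNorm f l

lemma kernelNorm_tsum_le {α : Type*} (f : α → ι → ι → ℝ≥0∞) :
    kernelNorm (fun k l => ∑' n, f n k l) ≤ ∑' n, kernelNorm (f n) := by
  refine kernelNorm_le (fun k => ?_) (fun l => ?_) <;> rw [ENNReal.tsum_comm] <;>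
    refine ENNReal.tsum_le_tsum fun n => ?_
  · exact row_le_kernelNorm (f n) k
  · exact col_le_kernelNorm (f n) l

lemma kernelNorm_mul_le (f g : ι → ι → ℝ≥0∞) :
    kernelNorm (fun k l => ∑' m, f k m * g m l) ≤ kernelNorm f * kernelNorm g := by
  refine kernelNorm_le (fun k => ?_) (fun l => ?_) <;> rw [ENNReal.tsum_comm]
  · simp_rw [ENNReal.tsum_mul_left]
    calc ∑' m, f k m * ∑' l, g m l ≤ ∑' m, f k m * kernelNorm g := by
          gcongr; exact row_le_kernelNorm g _
      _ ≤ _ := by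
          rw [ENNReal.tsum_mul_right]; gcongr; exact row_le_kernelNorm f k
  · simp_rw [ENNReal.tsum_mul_right]
    calc ∑' m, (∑' k, f k m) * g m l ≤ ∑' m, kernelNorm f * g m l := by
          gcongr; exact col_le_kernelNorm f _
      _ ≤ _ := by
          rw [ENNReal.tsum_mul_left]; gcongr; exact col_le_kernelNorm g l

end Kernel

/-! ### Inequalities for series, and the doubling recursion. -/

lemma ennreal_tsum_rpow_le {α : Type*} (x : α → ℝ≥0∞) {p : ℝ} (hp0 : 0 < p) (hp1 : p ≤ 1) :
    (∑' i, x i) ^ p ≤ ∑' i, x i ^ p := by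
  have hfin : ∀ s : Finset α, (∑ i ∈ s, x i) ^ p ≤ ∑ i ∈ s, x i ^ p := by
    classical
    intro s
    induction s using Finset.induction_on with
    | empty => simp [hp0]
    | insert a s ha ih =>
      rw [Finset.sum_insert ha, Finset.sum_insert ha]
      exact (ENNReal.rpow_add_le_add_rpow _ _ hp0.le hp1).trans (by gcongr)
  have hlim := (ENNReal.continuous_rpow_const (y := p)).continuousAt.tendsto.comp
    (ENNReal.summable (f := x)).hasSum
  exact le_of_tendsto' hlim fun s => (hfin s).trans (ENNReal.sum_le_tsum s)

lemma tsum_le_rpow_inv {α : Type*} (x : α → ℝ≥0∞) {p : ℝ} (hp0 : 0 < p) (hp1 : p ≤ 1) :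
    ∑' i, x i ≤ (∑' i, x i ^ p) ^ p⁻¹ :=
  (ENNReal.le_rpow_inv_iff hp0).2 (ennreal_tsum_rpow_le x hp0 hp1)

/-- This is the inclusion of `ℓ^p` in `ℓ^1`, uniformly over rows and columns; it opens the way to
Schur's test. -/
lemma kernelNorm_lt_top_of_rpow {ι : Type*} {f : ι → ι → ℝ≥0∞} {p : ℝ} (hp0 : 0 < p)
    (hp1 : p ≤ 1) (h : kernelNorm (fun k l => f k l ^ p) < ∞) : kernelNorm f < ∞ := by
  refine (kernelNorm_le (C := kernelNorm (fun k l => f k l ^ p) ^ p⁻¹) (fun k => ?_)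
    (fun l => ?_)).trans_lt (ENNReal.rpow_lt_top_of_nonneg (by positivity) h.ne)
  · refine (tsum_le_rpow_inv _ hp0 hp1).trans ?_
    gcongr
    exact row_le_kernelNorm (fun k l => f k l ^ p) k
  · refine (tsum_le_rpow_inv _ hp0 hp1).trans ?_
    gcongr
    exact col_le_kernelNorm (fun k l => f k l ^ p) l

lemma ennreal_tsum_mul_sq_le {α : Type*} (a x : α → ℝ≥0∞) :
    (∑' i, a i * x i) ^ 2 ≤ (∑' i, a i) * ∑' i, a i * x i ^ 2 := by
  have hfin : ∀ s : Finset α,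
      (∑ i ∈ s, a i * x i) ^ 2 ≤ (∑ i ∈ s, a i) * ∑ i ∈ s, a i * x i ^ 2 := by
    intro s
    have h := ENNReal.inner_le_weight_mul_Lp_of_nonneg s (p := 2) (by norm_num) a x
    calc _ ≤ _ := pow_le_pow_left' h 2
      _ = _ := by
        rw [mul_pow, ← ENNReal.rpow_mul_natCast, ← ENNReal.rpow_mul_natCast]
        norm_num
  have hlim := (ENNReal.continuous_pow 2).continuousAt.tendsto.comp
    (ENNReal.summable (f := fun i => a i * x i)).hasSum
  refine le_of_tendsto' hlim fun s => (hfin s).trans ?_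
  gcongr <;> exact ENNReal.sum_le_tsum s

/-- A sequence `a` with `a (2 n) ≲ a n * wⁿ * (1 + a n)` for some `w < 1` decays geometrically. -/
lemma summable_of_doubling {a : ℕ → ℝ} {C D w : ℝ} (ha : ∀ n, 0 ≤ a n) (hC : 0 ≤ C) (hD : 0 ≤ D)
    (hw0 : 0 < w) (hw1 : w < 1) (hstep : ∀ n, a (n + 1) ≤ D * a n)
    (hdouble : ∀ n, a (2 * n) ≤ a n * (C * w ^ n * (1 + a n))) : Summable a := by
  set s := √w with hs
  have hs0 : 0 < s := Real.sqrt_pos.2 hw0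
  have hs1 : s < 1 := by rw [hs, Real.sqrt_lt' one_pos]; simpa using hw1
  have hsw : s ^ 2 = w := Real.sq_sqrt hw0.le
  let P : ℝ → Prop := fun M => ∃ K, 1 ≤ K ∧ ∀ n, a n ≤ K * M ^ n
  -- Doubling squares `M ^ m` but gains `w ^ m = s ^ (2 * m)`, so the rate improves by the factor
  -- `s`. The condition `1 ≤ M` lets the summand 1 in `1 + a m` be absorbed.
  have himp : ∀ M, 1 ≤ M → P M → P (M * s) := by
    rintro M hM ⟨K, hK, h⟩
    have hM0 : 0 < M := by linarith
    have heven : ∀ m, a (2 * m) ≤ 2 * C * K ^ 2 * (M * s) ^ (2 * m) := by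
      intro m
      have h1 : (1 : ℝ) ≤ K * M ^ m := one_le_mul_of_one_le_of_one_le hK (one_le_pow₀ hM)
      calc a (2 * m) ≤ a m * (C * w ^ m * (1 + a m)) := hdouble m
        _ ≤ (K * M ^ m) * (C * w ^ m * (K * M ^ m + K * M ^ m)) := by
          have := ha m
          have := h m
          gcongr
        _ = 2 * C * K ^ 2 * (M ^ 2 * s ^ 2) ^ m := by rw [mul_pow, hsw]; ring
        _ = _ := by rw [← mul_pow, ← pow_mul]
    have hMs : 0 < M * s := by positivity
    -- The last constant serves odd indices, reached from even ones at the cost of a factor `D`.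
    refine ⟨max 1 (max (2 * C * K ^ 2) (D * (2 * C * K ^ 2) / (M * s))), le_max_left _ _, ?_⟩
    intro n
    obtain ⟨m, rfl | rfl⟩ := n.even_or_odd'
    · refine (heven m).trans ?_
      gcongr
      exact (le_max_left _ _).trans (le_max_right _ _)
    · calc a (2 * m + 1) ≤ D * (2 * C * K ^ 2 * (M * s) ^ (2 * m)) :=
            (hstep _).trans (by gcongr; exact heven m)
        _ = D * (2 * C * K ^ 2) / (M * s) * (M * s) ^ (2 * m + 1) := by
            rw [pow_succ (M * s), div_mul_eq_mul_div, eq_div_iff hMs.ne']; ring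
        _ ≤ _ := by
            gcongr
            exact (le_max_right _ _).trans (le_max_right _ _)
  -- The improvement is available only while the rate is at least 1; below 1 the goal is already
  -- reached.
  have hiter : ∀ j : ℕ, (∃ M, 0 ≤ M ∧ M < 1 ∧ P M) ∨ P (max D 1 * s ^ j) := by
    intro j
    induction j with
    | zero =>
      refine Or.inr ⟨max 1 (a 0), le_max_left _ _, fun n => ?_⟩
      induction n with
      | zero => simp
      | succ n ih =>
        calc a (n + 1) ≤ D * a n := hstep n
          _ ≤ max D 1 * (max 1 (a 0) * (max D 1 * s ^ 0) ^ n) := by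
            gcongr
            · exact ha n
            · exact le_max_left _ _
          _ = _ := by ring
    | succ j ih =>
      rcases ih with ih | ih
      · exact Or.inl ih
      · rcases lt_or_ge (max D 1 * s ^ j) 1 with hlt | hge
        · exact Or.inl ⟨_, by positivity, hlt, ih⟩
        · right
          rw [pow_succ, ← mul_assoc]
          exact himp _ hge ih
  obtain ⟨M, hM0, hM1, K, -, hK⟩ : ∃ M, 0 ≤ M ∧ M < 1 ∧ P M := by
    obtain ⟨j, hj⟩ := exists_pow_lt_of_lt_one (show 0 < (max D 1)⁻¹ by positivity) hs1
    refine (hiter j).elim id fun h => ⟨_, by positivity, ?_, h⟩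
    rwa [← lt_inv_mul_iff₀ (by positivity), mul_one]
  exact Summable.of_nonneg_of_le ha hK ((summable_geometric_of_lt_one hM0 hM1).mul_left K)

/-! ### Operators on `ℓ²` and their matrices. -/

section SquareSummable

variable {ι H : Type*} [NormedAddCommGroup H]

lemma tsum_enorm_sq_eq (x : lp (fun _ : ι => H) 2) : ∑' i, ‖x i‖ₑ ^ 2 = ‖x‖ₑ ^ 2 := by
  have h := lp.hasSum_norm (p := 2) (by norm_num) x
  simp only [ENNReal.toReal_ofNat, Real.rpow_ofNat] at h
  rw [← ofReal_norm, ← ENNReal.ofReal_pow (norm_nonneg _), ← h.tsum_eq,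
    ENNReal.ofReal_tsum_of_nonneg (fun _ => by positivity) h.summable]
  exact tsum_congr fun i => by rw [← ofReal_norm, ENNReal.ofReal_pow (norm_nonneg _)]

lemma memℓp_two_of_tsum_enorm_sq {f : ι → H} (hf : ∑' i, ‖f i‖ₑ ^ 2 ≠ ∞) : Memℓp f 2 := by
  refine memℓp_gen ?_
  have h := ENNReal.summable_toReal hf
  simpa using h

end SquareSummable

section Entries

variable {ι H : Type*} [NormedAddCommGroup H] [InnerProductSpace ℂ H]

open Classical in
/-- The `(k, l)` matrix entry of a bounded operator on `ℓ²(ι, H)`, as a function of the operator. -/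
noncomputable def entryCLM (k l : ι) :
    (lp (fun _ : ι => H) 2 →L[ℂ] lp (fun _ : ι => H) 2) →L[ℂ] (H →L[ℂ] H) :=
  (ContinuousLinearMap.compL ℂ H (lp (fun _ : ι => H) 2) H (lp.evalCLM ℂ (fun _ : ι => H) 2 k)) ∘L
    ((ContinuousLinearMap.compL ℂ H (lp (fun _ : ι => H) 2) (lp (fun _ : ι => H) 2)).flip
      (lp.singleContinuousLinearMap ℂ (fun _ : ι => H) 2 l))

/-- The matrix of a bounded operator on `ℓ²(ι, H)`. -/
noncomputable def entry (T : lp (fun _ : ι => H) 2 →L[ℂ] lp (fun _ : ι => H) 2) :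
    Matrix ι ι (H →L[ℂ] H) :=
  Matrix.of fun k l => entryCLM k l T

variable (S T : lp (fun _ : ι => H) 2 →L[ℂ] lp (fun _ : ι => H) 2)

lemma entry_apply [DecidableEq ι] (k l : ι) (v : H) :
    entry T k l v = T (lp.single 2 l v) k := by
  -- `entryCLM` was built with the classical instance, which is substituted for the given one.
  obtain rfl : ‹DecidableEq ι› = fun a b => Classical.propDecidable (a = b) :=
    Subsingleton.elim _ _
  rfl

lemma norm_entry_le (k l : ι) : ‖entry T k l‖ ≤ ‖T‖ := by
  classical
  refine ContinuousLinearMap.opNorm_le_bound _ (norm_nonneg T) fun v => ?_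
  rw [entry_apply, ← lp.norm_single (E := fun _ : ι => H) (p := 2) (by norm_num) l v]
  exact (lp.norm_apply_le_norm (by norm_num) _ k).trans (T.le_opNorm _)

lemma enorm_entry_le (k l : ι) : ‖entry T k l‖ₑ ≤ ‖T‖ₑ :=
  enorm_le_iff_norm_le.2 (norm_entry_le T k l)

lemma hasSum_entry (x : lp (fun _ : ι => H) 2) (k : ι) :
    HasSum (fun l => entry T k l (x l)) (T x k) := by
  classical
  exact (lp.hasSum_single (by norm_num) x).mapL ((lp.evalCLM ℂ (fun _ : ι => H) 2 k) ∘L T)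

lemma hasSum_entry_mul_apply (k l : ι) (v : H) :
    HasSum (fun m => entry S k m (entry T m l v)) (entry (S * T) k l v) := by
  classical
  exact hasSum_entry S (T (lp.single 2 l v)) k

lemma entry_one [DecidableEq ι] : entry (1 : lp (fun _ : ι => H) 2 →L[ℂ] lp (fun _ : ι => H) 2) = 1 := by
  ext k l v
  rw [entry_apply, one_apply_eq_self, lp.single_apply, Matrix.one_apply, Pi.single_apply]
  split_ifs <;> simp

lemma entry_sub : entry (S - T) = entry S - entry T := by
  ext k l v; simp [entry]

lemma entry_smul (c : ℂ) : entry (c • T) = c • entry T := by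
  ext k l v; simp [entry]

lemma entry_injective :
    Function.Injective (entry : (lp (fun _ : ι => H) 2 →L[ℂ] lp (fun _ : ι => H) 2) → _) := by
  intro S T h
  ext x k
  exact (h ▸ hasSum_entry S x k).unique (hasSum_entry T x k)

/-- Strong convergence of the product series suffices; the right-hand side may be infinite. -/
lemma enorm_entry_mul_le (k l : ι) :
    ‖entry (S * T) k l‖ₑ ≤ ∑' m, ‖entry S k m‖ₑ * ‖entry T m l‖ₑ := by
  refine ContinuousLinearMap.opENorm_le_bound _ fun v => ?_
  rw [← ENNReal.tsum_mul_right]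
  refine (hasSum_entry_mul_apply S T k l v).enorm_le_of_bounded ENNReal.summable.hasSum fun m => ?_
  rw [mul_assoc]
  exact (ContinuousLinearMap.le_opENorm _ _).trans
    (by gcongr; exact ContinuousLinearMap.le_opENorm _ _)

lemma summable_of_tsum_enorm_ne_top {α E : Type*} [NormedAddCommGroup E] [CompleteSpace E]
    {f : α → E} (h : ∑' i, ‖f i‖ₑ ≠ ∞) : Summable f := by
  refine Summable.of_norm ?_
  simpa using ENNReal.summable_toReal h

variable [CompleteSpace H]

lemma entry_adjoint : entry (star T) = (entry T).conjTranspose := by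
  classical
  ext k l v
  refine ext_inner_left ℂ fun u => ?_
  rw [entry_apply, Matrix.conjTranspose_apply, ContinuousLinearMap.star_eq_adjoint,
    ContinuousLinearMap.star_eq_adjoint, ContinuousLinearMap.adjoint_inner_right, entry_apply]
  exact (lp.inner_single_left (𝕜 := ℂ) (G := fun _ : ι => H) k u _).symm.trans
    ((ContinuousLinearMap.adjoint_inner_right T _ _).trans
      (lp.inner_single_right (𝕜 := ℂ) (G := fun _ : ι => H) l v _))

/-- For bounded operators this series converges strongly in general. Since the entries of `T` are
bounded by `‖T‖`, an absolutely summable row of `S` upgrades this to norm convergence, which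
`matMul` needs. -/
lemma hasSum_entry_mul {k : ι} (hS : ∑' m, ‖entry S k m‖ₑ ≠ ∞) (l : ι) :
    HasSum (fun m => entry S k m * entry T m l) (entry (S * T) k l) := by
  have hsum : Summable fun m => entry S k m * entry T m l := by
    refine summable_of_tsum_enorm_ne_top (ne_top_of_le_ne_top
      (ENNReal.mul_ne_top hS (enorm_ne_top (x := T))) ?_)
    rw [← ENNReal.tsum_mul_right]
    gcongr with m
    refine (ContinuousLinearMap.opENorm_comp_le _ _).trans ?_
    gcongr
    exact enorm_entry_le T m l
  convert hsum.hasSum using 1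
  ext v
  exact (hasSum_entry_mul_apply S T k l v).unique
    (hsum.hasSum.mapL (ContinuousLinearMap.apply ℂ H v))

/-- **Schur's test** on `ℓ²(ι, H)`. -/
lemma exists_entry_eq {A : Matrix ι ι (H →L[ℂ] H)}
    (hA : kernelNorm (fun k l => ‖A k l‖ₑ) < ∞) :
    ∃ T : lp (fun _ : ι => H) 2 →L[ℂ] lp (fun _ : ι => H) 2, entry T = A := by
  classical
  set M := kernelNorm (fun k l => ‖A k l‖ₑ) with hM
  have hrow : ∀ k, ∑' l, ‖A k l‖ₑ ≤ M := row_le_kernelNorm (fun k l => ‖A k l‖ₑ)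
  have hcol : ∀ l, ∑' k, ‖A k l‖ₑ ≤ M := col_le_kernelNorm (fun k l => ‖A k l‖ₑ)
  have hsum : ∀ (x : lp (fun _ : ι => H) 2) k, Summable fun l => A k l (x l) := by
    intro x k
    refine summable_of_tsum_enorm_ne_top (ne_top_of_le_ne_top
      (ENNReal.mul_ne_top hA.ne (enorm_ne_top (x := x))) ?_)
    refine le_trans ?_ (mul_le_mul_left (hrow k) _)
    rw [← ENNReal.tsum_mul_right]
    gcongr with l
    refine (ContinuousLinearMap.le_opENorm _ _).trans ?_
    gcongr
    exact enorm_le_iff_norm_le.2 (lp.norm_apply_le_norm (by norm_num) x l)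
  -- Cauchy–Schwarz with weights `‖A k l‖` costs a row sum; exchanging the sums costs a column sum.
  have hbound : ∀ x : lp (fun _ : ι => H) 2,
      ∑' k, ‖∑' l, A k l (x l)‖ₑ ^ 2 ≤ (M * ‖x‖ₑ) ^ 2 := by
    intro x
    calc ∑' k, ‖∑' l, A k l (x l)‖ₑ ^ 2
        ≤ ∑' k, M * ∑' l, ‖A k l‖ₑ * ‖x l‖ₑ ^ 2 := by
          gcongr with k
          refine le_trans ?_ ((ennreal_tsum_mul_sq_le (fun l => ‖A k l‖ₑ) fun l => ‖x l‖ₑ).trans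
            (mul_le_mul_left (hrow k) _))
          gcongr
          exact enorm_tsum_le_tsum_enorm.trans
            (ENNReal.tsum_le_tsum fun l => ContinuousLinearMap.le_opENorm _ _)
      _ = M * ∑' l, (∑' k, ‖A k l‖ₑ) * ‖x l‖ₑ ^ 2 := by
          rw [ENNReal.tsum_mul_left, ENNReal.tsum_comm]
          simp_rw [ENNReal.tsum_mul_right]
      _ ≤ M * ∑' l, M * ‖x l‖ₑ ^ 2 := by gcongr with l; exact hcol l
      _ = _ := by rw [ENNReal.tsum_mul_left, tsum_enorm_sq_eq]; ring
  have hmem : ∀ x : lp (fun _ : ι => H) 2, Memℓp (fun k => ∑' l, A k l (x l)) 2 := fun x =>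
    memℓp_two_of_tsum_enorm_sq (ne_top_of_le_ne_top
      (ENNReal.pow_ne_top (ENNReal.mul_ne_top hA.ne enorm_ne_top)) (hbound x))
  let L : lp (fun _ : ι => H) 2 →ₗ[ℂ] lp (fun _ : ι => H) 2 :=
    { toFun := fun x => ⟨fun k => ∑' l, A k l (x l), hmem x⟩
      map_add' := fun x y => by
        ext k
        exact (tsum_congr fun l => map_add (A k l) _ _).trans ((hsum x k).tsum_add (hsum y k))
      map_smul' := fun c x => by
        ext k
        exact (tsum_congr fun l => map_smul (A k l) _ _).trans ((hsum x k).tsum_const_smul c) }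
  have hL : ∀ x, ‖L x‖ ≤ M.toReal * ‖x‖ := by
    intro x
    have h : ‖L x‖ₑ ^ 2 ≤ (M * ‖x‖ₑ) ^ 2 := by
      rw [← tsum_enorm_sq_eq]
      exact hbound x
    have h' : ‖L x‖ₑ ≤ M * ‖x‖ₑ := (ENNReal.pow_le_pow_left_iff two_ne_zero).1 h
    simpa using ENNReal.toReal_mono (ENNReal.mul_ne_top hA.ne enorm_ne_top) h'
  refine ⟨L.mkContinuous M.toReal hL, ?_⟩
  ext k l v
  rw [entry_apply]
  change ∑' m, A k m (lp.single (E := fun _ : ι => H) 2 l v m) = A k l v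
  rw [tsum_eq_single l]
  · rw [lp.single_apply_self]
  · intro m hm
    rw [lp.single_apply_ne _ _ _ hm, map_zero]

end Entries

lemma hasSum_enorm_le_tsum {α E : Type*} [NormedAddCommGroup E] {f : α → E} {a : E}
    (h : HasSum f a) : ‖a‖ₑ ≤ ∑' i, ‖f i‖ₑ :=
  h.enorm_le_of_bounded ENNReal.summable.hasSum fun _ => le_rfl

/-! ### Weighted Schur norms of operators. -/

section OperatorNorm

variable {ι H : Type*} [NormedAddCommGroup H] [InnerProductSpace ℂ H]

/-- The weighted Schur `p`-norm of the matrix of a bounded operator on `ℓ²(ι, H)`, where the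
`p`-th power of the weight is the kernel `w`. -/
noncomputable def opSchurNorm (p : ℝ) (w : ι → ι → ℝ≥0∞)
    (T : lp (fun _ : ι => H) 2 →L[ℂ] lp (fun _ : ι => H) 2) : ℝ≥0∞ :=
  kernelNorm fun k l => ‖entry T k l‖ₑ ^ p * w k l

variable {p : ℝ} {w : ι → ι → ℝ≥0∞}
  (S T : lp (fun _ : ι => H) 2 →L[ℂ] lp (fun _ : ι => H) 2)

lemma opSchurNorm_mono {w' : ι → ι → ℝ≥0∞} (h : ∀ k l, w k l ≤ w' k l) :
    opSchurNorm p w T ≤ opSchurNorm p w' T :=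
  kernelNorm_mono fun k l => by gcongr; exact h k l

lemma opSchurNorm_one_le (hp0 : 0 < p) (hw : ∀ k, w k k ≤ 1) :
    opSchurNorm p w (1 : lp (fun _ : ι => H) 2 →L[ℂ] lp (fun _ : ι => H) 2) ≤ 1 := by
  classical
  have h : ∀ k l, ‖entry (1 : lp (fun _ : ι => H) 2 →L[ℂ] lp (fun _ : ι => H) 2) k l‖ₑ ^ p * w k l
      ≤ if k = l then 1 else 0 := by
    intro k l
    rw [entry_one, Matrix.one_apply]
    split_ifs with hkl
    · subst hkl
      have h1 : ‖(1 : H →L[ℂ] H)‖ₑ ≤ 1 := by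
        rw [← ofReal_norm]
        exact ENNReal.ofReal_le_one.2 ContinuousLinearMap.norm_id_le
      exact mul_le_one' (ENNReal.rpow_le_one h1 hp0.le) (hw k)
    · rw [← ofReal_norm, norm_zero, ENNReal.ofReal_zero, ENNReal.zero_rpow_of_pos hp0, zero_mul]
  refine (kernelNorm_mono h).trans (kernelNorm_le (fun k => ?_) (fun l => ?_)) <;> simp

lemma opSchurNorm_smul_le (hp0 : 0 < p) (c : ℂ) :
    opSchurNorm p w (c • T) ≤ ‖c‖ₑ ^ p * opSchurNorm p w T := by
  refine le_trans (kernelNorm_mono fun k l => ?_) (kernelNorm_const_mul _ _)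
  rw [entry_smul, Matrix.smul_apply, enorm_smul, ENNReal.mul_rpow_of_nonneg _ _ hp0.le, mul_assoc]

lemma opSchurNorm_sub_le (hp0 : 0 < p) (hp1 : p ≤ 1) :
    opSchurNorm p w (S - T) ≤ opSchurNorm p w S + opSchurNorm p w T := by
  refine le_trans (kernelNorm_mono fun k l => ?_) (kernelNorm_add_le _ _)
  rw [entry_sub, Matrix.sub_apply, ← add_mul]
  gcongr
  refine le_trans ?_ (ENNReal.rpow_add_le_add_rpow _ _ hp0.le hp1)
  gcongr
  exact enorm_sub_le

/-- For a subadditive weight, the weighted Schur norm of a product is controlled by a weighted norm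
of one factor and the unweighted norm of the other. -/
lemma opSchurNorm_mul_le (hp0 : 0 < p) (hp1 : p ≤ 1) (hw : ∀ k m l, w k l ≤ w k m + w m l) :
    opSchurNorm p w (S * T) ≤
      opSchurNorm p w S * opSchurNorm p 1 T + opSchurNorm p 1 S * opSchurNorm p w T := by
  refine le_trans (kernelNorm_mono fun k l => ?_) ((kernelNorm_add_le _ _).trans
    (add_le_add (kernelNorm_mul_le _ _) (kernelNorm_mul_le _ _)))
  rw [← ENNReal.tsum_add]
  calc ‖entry (S * T) k l‖ₑ ^ p * w k l
      ≤ (∑' m, ‖entry S k m‖ₑ ^ p * ‖entry T m l‖ₑ ^ p) * w k l := by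
        gcongr
        refine (ENNReal.rpow_le_rpow (enorm_entry_mul_le S T k l) hp0.le).trans
          ((ennreal_tsum_rpow_le _ hp0 hp1).trans_eq (tsum_congr fun m => ?_))
        rw [ENNReal.mul_rpow_of_nonneg _ _ hp0.le]
    _ ≤ _ := by
        rw [← ENNReal.tsum_mul_right]
        refine ENNReal.tsum_le_tsum fun m => ?_
        refine (mul_le_mul_right (hw k m l) _).trans_eq ?_
        simp only [Pi.one_apply, mul_one]
        ring

/-- Convergence in operator norm gives convergence of each entry, and `t ↦ t ^ p` is subadditive.
Completeness of the Schur class is thus not needed. -/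
lemma opSchurNorm_hasSum_le (hp0 : 0 < p) (hp1 : p ≤ 1) {α : Type*}
    {F : α → lp (fun _ : ι => H) 2 →L[ℂ] lp (fun _ : ι => H) 2} (hF : HasSum F S) :
    opSchurNorm p w S ≤ ∑' n, opSchurNorm p w (F n) := by
  refine le_trans (kernelNorm_mono fun k l => ?_) (kernelNorm_tsum_le _)
  rw [ENNReal.tsum_mul_right]
  gcongr
  refine le_trans ?_ (ennreal_tsum_rpow_le _ hp0 hp1)
  gcongr
  have h : HasSum (fun n => entry (F n) k l) (entry S k l) := hF.mapL (entryCLM k l)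
  exact hasSum_enorm_le_tsum h

/-- Splitting the entries of a bounded operator into a band, in which they are bounded by the
operator norm, and a remainder, on which the weight is large. -/
lemma opSchurNorm_one_le_band_add (hp0 : 0 < p) (s : ι → ι → Prop) {N c : ℝ≥0∞}
    (hrow : ∀ k, ({l | s k l}.encard : ℝ≥0∞) ≤ N) (hcol : ∀ l, ({k | s k l}.encard : ℝ≥0∞) ≤ N)
    (hw : ∀ k l, ¬ s k l → 1 ≤ c * w k l) :
    opSchurNorm p 1 T ≤ N * ‖T‖ₑ ^ p + c * opSchurNorm p w T := by
  classical
  have hpt : ∀ k l, ‖entry T k l‖ₑ ^ p * (1 : ι → ι → ℝ≥0∞) k l ≤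
      ‖T‖ₑ ^ p * (if s k l then 1 else 0) + c * (‖entry T k l‖ₑ ^ p * w k l) := by
    intro k l
    split_ifs with h
    · simp only [Pi.one_apply, mul_one]
      exact (ENNReal.rpow_le_rpow (enorm_entry_le T k l) hp0.le).trans le_self_add
    · rw [mul_zero, zero_add, mul_left_comm]
      gcongr
      exact hw k l h
  refine (kernelNorm_mono hpt).trans ((kernelNorm_add_le _ _).trans ?_)
  gcongr
  · rw [mul_comm N]
    refine (kernelNorm_const_mul _ _).trans ?_
    gcongr
    have hind : ∀ u : Set ι, ∑' i, (if i ∈ u then 1 else 0 : ℝ≥0∞) = u.encard := fun u => by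
      rw [← ENNReal.tsum_set_one, tsum_subtype u fun _ => (1 : ℝ≥0∞)]
      rfl
    exact kernelNorm_le (fun k => (hind {l | s k l}).trans_le (hrow k))
      (fun l => (hind {k | s k l}).trans_le (hcol l))
  · exact kernelNorm_const_mul _ _

end OperatorNorm

/-! ### Counting points and the polynomial weight. -/

lemma encard_biUnion_finset_le {α β : Type*} (s : Finset α) (f : α → Set β) :
    (⋃ i ∈ s, f i).encard ≤ ∑ i ∈ s, (f i).encard := by
  classical
  induction s using Finset.induction_on with
  | empty => simp
  | insert a s ha ih =>
    rw [Finset.set_biUnion_insert, Finset.sum_insert ha]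
    exact (Set.encard_union_le _ _).trans (by gcongr)

section Geometry

variable {d : ℕ} {X : Set (EuclideanSpace ℝ (Fin d))}

/-- The ball is covered by the unit cubes at `x + z`, with `z` integral and `|z i| ≤ m`. -/
lemma IsRelativelySeparated.exists_encard_le (hX : IsRelativelySeparated X) :
    ∃ N : ℕ, ∀ (x : EuclideanSpace ℝ (Fin d)) (m : ℕ),
      (X ∩ {y | ‖y - x‖ ≤ m}).encard ≤ (N * (2 * m + 1) ^ d : ℕ) := by
  classical
  obtain ⟨-, N, hN⟩ := hX
  refine ⟨N, fun x m => ?_⟩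
  let box : Finset (Fin d → ℤ) := Fintype.piFinset fun _ => Finset.Icc (-(m : ℤ)) m
  let cube : (Fin d → ℤ) → Set (EuclideanSpace ℝ (Fin d)) := fun z =>
    X ∩ {y | ∀ i, (x + WithLp.toLp 2 fun i => (z i : ℝ)) i ≤ y i ∧
      y i ≤ (x + WithLp.toLp 2 fun i => (z i : ℝ)) i + 1}
  have hcover : X ∩ {y | ‖y - x‖ ≤ m} ⊆ ⋃ z ∈ box, cube z := by
    rintro y ⟨hyX, hy⟩
    simp only [Set.mem_iUnion]
    refine ⟨fun i => ⌊y i - x i⌋, ?_, hyX, fun i => ?_⟩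
    · refine Fintype.mem_piFinset.2 fun i => Finset.mem_Icc.2 ?_
      have hi : |y i - x i| ≤ m := (PiLp.norm_apply_le (y - x) i).trans hy
      obtain ⟨h1, h2⟩ := abs_le.1 hi
      exact ⟨Int.le_floor.2 (by push_cast; exact h1),
        Int.cast_le.1 ((Int.floor_le _).trans (by exact_mod_cast h2) : ((_ : ℤ) : ℝ) ≤ ((m : ℤ) : ℝ))⟩
    · have h1 := Int.floor_le (y i - x i)
      have h2 := Int.lt_floor_add_one (y i - x i)
      simp only [PiLp.add_apply]
      constructor <;> linarith
  calc (X ∩ {y | ‖y - x‖ ≤ m}).encard ≤ (⋃ z ∈ box, cube z).encard := Set.encard_le_encard hcover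
    _ ≤ ∑ z ∈ box, (cube z).encard := encard_biUnion_finset_le box cube
    _ ≤ ∑ z ∈ box, (N : ℕ∞) := Finset.sum_le_sum fun z _ => hN _
    _ = (N * (2 * m + 1) ^ d : ℕ) := by
      have hcard : (Finset.Icc (-(m : ℤ)) m).card = 2 * m + 1 := by
        rw [Int.card_Icc]; omega
      rw [Finset.sum_const, Fintype.card_piFinset, Finset.prod_const, hcard, Finset.card_univ,
        Fintype.card_fin, nsmul_eq_mul]
      push_cast
      ring

lemma one_le_polyWeight {ε : ℝ} (hε : 0 ≤ ε) (x : EuclideanSpace ℝ (Fin d)) :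
    1 ≤ polyWeight ε x :=
  Real.one_le_rpow (by linarith [norm_nonneg x]) hε

/-- Since `1 + |x + y| ≤ (1 + |x|) + (1 + |y|)`, this is subadditivity of `t ↦ t ^ ε` for `ε ≤ 1`.
-/
lemma polyWeight_add_le {ε : ℝ} (hε0 : 0 ≤ ε) (hε1 : ε ≤ 1) (x y : EuclideanSpace ℝ (Fin d)) :
    polyWeight ε (x + y) ≤ polyWeight ε x + polyWeight ε y := by
  have hx := norm_nonneg x
  have hy := norm_nonneg y
  refine le_trans ?_ (Real.rpow_add_le_add_rpow (by positivity) (by positivity) hε0 hε1)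
  exact Real.rpow_le_rpow (by positivity) (by linarith [norm_add_le x y]) hε0

/-- The kernel `(k, l) ↦ (1 + |k - l|)^ε` on `X`. -/
noncomputable def polyKernel (ε : ℝ) (k l : X) : ℝ≥0∞ :=
  ENNReal.ofReal (polyWeight ε ((k : EuclideanSpace ℝ (Fin d)) - (l : EuclideanSpace ℝ (Fin d))))

lemma one_le_polyKernel {ε : ℝ} (hε : 0 ≤ ε) (k l : X) : 1 ≤ polyKernel ε k l :=
  ENNReal.one_le_ofReal.2 (one_le_polyWeight hε _)

lemma polyKernel_self (ε : ℝ) (k : X) : polyKernel ε k k = 1 := by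
  simp [polyKernel, polyWeight]

lemma polyKernel_le_add {ε : ℝ} (hε0 : 0 ≤ ε) (hε1 : ε ≤ 1) (k m l : X) :
    polyKernel ε k l ≤ polyKernel ε k m + polyKernel ε m l := by
  unfold polyKernel
  rw [← ENNReal.ofReal_add (zero_le_one.trans (one_le_polyWeight hε0 _))
    (zero_le_one.trans (one_le_polyWeight hε0 _))]
  refine ENNReal.ofReal_le_ofReal ?_
  rw [← sub_add_sub_cancel (k : EuclideanSpace ℝ (Fin d)) (m : EuclideanSpace ℝ (Fin d)) l]
  exact polyWeight_add_le hε0 hε1 _ _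

end Geometry

/-! ### Brandenburg's trick and the Neumann series. -/

section PolynomialWeight

variable {d : ℕ} {X : Set (EuclideanSpace ℝ (Fin d))}
  {H : Type*} [NormedAddCommGroup H] [InnerProductSpace ℂ H]

/-- The band is `|k - l| ≤ m`; outside it the weight exceeds `m ^ ε`. As `N` depends on neither `m`
nor `T`, the width can later be adapted to each power. -/
lemma IsRelativelySeparated.exists_opSchurNorm_one_le (hX : IsRelativelySeparated X) (H : Type*)
    [NormedAddCommGroup H] [InnerProductSpace ℂ H] {p : ℝ} (hp0 : 0 < p) {ε : ℝ} (hε : 0 ≤ ε) :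
    ∃ N : ℕ, ∀ (m : ℕ) (T : lp (fun _ : X => H) 2 →L[ℂ] lp (fun _ : X => H) 2), 0 < m →
      opSchurNorm p 1 T ≤ (N * (2 * m + 1) ^ d : ℕ) * ‖T‖ₑ ^ p +
        ENNReal.ofReal ((m : ℝ) ^ (-ε)) * opSchurNorm p (polyKernel ε) T := by
  obtain ⟨N, hN⟩ := hX.exists_encard_le
  have hball : ∀ (k : X) (m : ℕ), ({l : X | ‖(l : EuclideanSpace ℝ (Fin d)) -
      (k : EuclideanSpace ℝ (Fin d))‖ ≤ m}.encard : ℝ≥0∞) ≤ (N * (2 * m + 1) ^ d : ℕ) := by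
    intro k m
    rw [← ENat.toENNReal_coe, ENat.toENNReal_le, ← Subtype.val_injective.encard_image]
    refine (Set.encard_le_encard ?_).trans (hN k m)
    rintro _ ⟨l, hl, rfl⟩
    exact ⟨l.2, hl⟩
  refine ⟨N, fun m T hm => opSchurNorm_one_le_band_add T hp0
    (fun k l => ‖(l : EuclideanSpace ℝ (Fin d)) - (k : EuclideanSpace ℝ (Fin d))‖ ≤ m)
    (fun k => hball k m) (fun l => ?_) fun k l hkl => ?_⟩
  · simp_rw [norm_sub_rev (l : EuclideanSpace ℝ (Fin d))]
    exact hball l m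
  · have hm0 : (0 : ℝ) < m := by exact_mod_cast hm
    rw [polyKernel, ← ENNReal.ofReal_mul (by positivity), ENNReal.one_le_ofReal,
      Real.rpow_neg hm0.le, ← div_eq_inv_mul, one_le_div (by positivity), polyWeight]
    rw [not_le, norm_sub_rev] at hkl
    exact Real.rpow_le_rpow hm0.le (by linarith) hε

/-- **Brandenburg's trick**: the powers of a contraction whose matrix lies in the weighted Schur
class are summable in the weighted Schur norm. -/
lemma IsRelativelySeparated.tsum_opSchurNorm_pow_ne_top (hX : IsRelativelySeparated X) {p : ℝ}
    (hp0 : 0 < p) (hp1 : p ≤ 1) {ε : ℝ} (hε0 : 0 < ε) (hε1 : ε ≤ 1)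
    {T : lp (fun _ : X => H) 2 →L[ℂ] lp (fun _ : X => H) 2} (hT : ‖T‖ < 1)
    (hTS : opSchurNorm p (polyKernel ε) T < ∞) :
    ∑' n : ℕ, opSchurNorm p (polyKernel ε) (T ^ n) ≠ ∞ := by
  have hmono : ∀ S : lp (fun _ : X => H) 2 →L[ℂ] lp (fun _ : X => H) 2,
      opSchurNorm p 1 S ≤ opSchurNorm p (polyKernel ε) S := fun S =>
    opSchurNorm_mono S fun k l => one_le_polyKernel hε0.le k l
  have hmul : ∀ S R : lp (fun _ : X => H) 2 →L[ℂ] lp (fun _ : X => H) 2,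
      opSchurNorm p (polyKernel ε) (S * R) ≤ opSchurNorm p (polyKernel ε) S * opSchurNorm p 1 R +
        opSchurNorm p 1 S * opSchurNorm p (polyKernel ε) R := fun S R =>
    opSchurNorm_mul_le S R hp0 hp1 (polyKernel_le_add hε0.le hε1)
  have hpowle : ∀ n : ℕ, ‖T ^ n‖ₑ ≤ ‖T‖ₑ ^ n := by
    intro n
    have h1 : ‖(1 : lp (fun _ : X => H) 2 →L[ℂ] lp (fun _ : X => H) 2)‖ ≤ 1 :=
      ContinuousLinearMap.norm_id_le
    have h : ‖T ^ n‖ ≤ ‖T‖ ^ n := by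
      -- The space may be trivial, so only `‖1‖ ≤ 1` is available at exponent 0.
      rcases n.eq_zero_or_pos with rfl | hn
      · simpa using h1
      · exact norm_pow_le' T hn
    rw [← ofReal_norm, ← ofReal_norm, ← ENNReal.ofReal_pow (norm_nonneg T)]
    exact ENNReal.ofReal_le_ofReal h
  have hfin : ∀ n : ℕ, opSchurNorm p (polyKernel ε) (T ^ n) < ∞ := by
    intro n
    induction n with
    | zero =>
      rw [pow_zero]
      exact (opSchurNorm_one_le hp0 fun k => (polyKernel_self ε k).le).trans_lt ENNReal.one_lt_top
    | succ n ih =>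
      rw [pow_succ]
      exact (hmul _ _).trans_lt (ENNReal.add_lt_top.2
        ⟨ENNReal.mul_lt_top ih ((hmono _).trans_lt hTS),
          ENNReal.mul_lt_top ((hmono _).trans_lt ih) hTS⟩)
  obtain ⟨N, hN⟩ := hX.exists_opSchurNorm_one_le H hp0 hε0.le
  set a : ℕ → ℝ := fun n => (opSchurNorm p (polyKernel ε) (T ^ n)).toReal with ha
  set b : ℕ → ℝ := fun n => (opSchurNorm p 1 (T ^ n)).toReal with hb
  have hbfin : ∀ n : ℕ, opSchurNorm p 1 (T ^ n) ≠ ∞ := fun n => ((hmono _).trans_lt (hfin n)).ne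
  have hab : ∀ n, b n ≤ a n := fun n => ENNReal.toReal_mono (hfin n).ne (hmono _)
  have ha0 : ∀ n, 0 ≤ a n := fun n => ENNReal.toReal_nonneg
  have hb0 : ∀ n, 0 ≤ b n := fun n => ENNReal.toReal_nonneg
  have hmulr : ∀ m n, a (m + n) ≤ a m * b n + b m * a n := by
    intro m n
    have h := ENNReal.toReal_mono (ENNReal.add_ne_top.2
      ⟨ENNReal.mul_ne_top (hfin m).ne (hbfin n), ENNReal.mul_ne_top (hbfin m) (hfin n).ne⟩)
      (hmul (T ^ m) (T ^ n))
    rwa [ENNReal.toReal_add (ENNReal.mul_ne_top (hfin m).ne (hbfin n))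
      (ENNReal.mul_ne_top (hbfin m) (hfin n).ne), ENNReal.toReal_mul, ENNReal.toReal_mul,
      ← pow_add] at h
  have hband : ∀ (n m : ℕ), 0 < m →
      b n ≤ N * (2 * m + 1) ^ d * (‖T‖ ^ p) ^ n + (m : ℝ) ^ (-ε) * a n := by
    intro n m hm
    have hnt : ∀ n : ℕ, ‖T ^ n‖ₑ ^ p ≤ ENNReal.ofReal ((‖T‖ ^ p) ^ n) := by
      intro n
      refine (ENNReal.rpow_le_rpow (hpowle n) hp0.le).trans_eq ?_
      rw [← ofReal_norm, ← ENNReal.ofReal_pow (norm_nonneg T),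
        ENNReal.ofReal_rpow_of_nonneg (by positivity) hp0.le, Real.rpow_pow_comm (norm_nonneg T)]
    have h : opSchurNorm p 1 (T ^ n) ≤ ENNReal.ofReal
        (N * (2 * m + 1) ^ d * (‖T‖ ^ p) ^ n + (m : ℝ) ^ (-ε) * a n) := by
      refine (hN m (T ^ n) hm).trans ?_
      have := ha0 n
      rw [ENNReal.ofReal_add (by positivity) (by positivity), ENNReal.ofReal_mul (by positivity),
        ENNReal.ofReal_mul (q := a n) (by positivity), ENNReal.ofReal_toReal (hfin n).ne]
      gcongr
      · rw [← ENNReal.ofReal_natCast]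
        push_cast
        rfl
      · exact hnt n
    have := ha0 n
    exact ENNReal.toReal_le_of_le_ofReal (by positivity) h
  -- For band width about `t ^ n`, the count `t ^ (d * n)` must not outweigh `‖T‖ ^ (p * n)`, while
  -- `1 < t` makes the remainder factor `t ^ (-ε * n)` decay.
  obtain ⟨t, ht1, htw⟩ : ∃ t : ℝ, 1 < t ∧ t ^ d * ‖T‖ ^ p < 1 := by
    have hcont : Filter.Tendsto (fun t : ℝ => t ^ d * ‖T‖ ^ p) (nhdsWithin 1 (Set.Ioi 1))
        (nhds (1 ^ d * ‖T‖ ^ p)) :=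
      Continuous.tendsto (f := fun t : ℝ => t ^ d * ‖T‖ ^ p) (by fun_prop) 1 |>.mono_left
        nhdsWithin_le_nhds
    have hlt : 1 ^ d * ‖T‖ ^ p < 1 := by
      rw [one_pow, one_mul]
      exact Real.rpow_lt_one (norm_nonneg T) hT hp0
    obtain ⟨t, h1, h2⟩ := ((hcont.eventually_lt_const hlt).and self_mem_nhdsWithin).exists
    exact ⟨t, h2, h1⟩
  have ht0 : 0 < t := one_pos.trans ht1
  set w := max (t ^ d * ‖T‖ ^ p) (t ^ (-ε)) with hw
  have hw0 : 0 < w := lt_max_of_lt_right (by positivity)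
  have hw1 : w < 1 := max_lt htw (Real.rpow_lt_one_of_one_lt_of_neg ht1 (by linarith))
  have hbw : ∀ n, b n ≤ (N * 5 ^ d + 1) * w ^ n * (1 + a n) := by
    intro n
    have htn : 1 ≤ t ^ n := one_le_pow₀ ht1.le
    have hm1 : t ^ n ≤ ⌈t ^ n⌉₊ := Nat.le_ceil _
    have hm2 : (⌈t ^ n⌉₊ : ℝ) < t ^ n + 1 := Nat.ceil_lt_add_one (by positivity)
    have hv : (⌈t ^ n⌉₊ : ℝ) ^ (-ε) ≤ w ^ n := by
      calc (⌈t ^ n⌉₊ : ℝ) ^ (-ε) ≤ (t ^ n) ^ (-ε) :=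
            Real.rpow_le_rpow_of_nonpos (by positivity) hm1 (by linarith)
        _ = (t ^ (-ε)) ^ n := (Real.rpow_pow_comm ht0.le _ _).symm
        _ ≤ w ^ n := by gcongr; exact le_max_right _ _
    -- The 5 comes from `2 * ⌈t ^ n⌉₊ + 1 ≤ 2 * t ^ n + 3 ≤ 5 * t ^ n`.
    have hu : (2 * (⌈t ^ n⌉₊ : ℝ) + 1) ^ d * (‖T‖ ^ p) ^ n ≤ 5 ^ d * w ^ n := by
      calc (2 * (⌈t ^ n⌉₊ : ℝ) + 1) ^ d * (‖T‖ ^ p) ^ n ≤ (5 * t ^ n) ^ d * (‖T‖ ^ p) ^ n := by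
            gcongr; linarith
        _ = 5 ^ d * (t ^ d * ‖T‖ ^ p) ^ n := by ring
        _ ≤ 5 ^ d * w ^ n := by gcongr; exact le_max_left _ _
    have han := ha0 n
    calc b n ≤ N * (2 * (⌈t ^ n⌉₊ : ℝ) + 1) ^ d * (‖T‖ ^ p) ^ n + (⌈t ^ n⌉₊ : ℝ) ^ (-ε) * a n :=
          hband n _ (Nat.ceil_pos.2 (by positivity))
      _ ≤ N * (5 ^ d * w ^ n) + w ^ n * a n := by rw [mul_assoc]; gcongr
      _ ≤ (N * 5 ^ d + 1) * w ^ n * (1 + a n) := by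
          have h1 : 0 ≤ N * 5 ^ d * w ^ n * a n := by positivity
          have h2 : 0 ≤ w ^ n := by positivity
          nlinarith
  have hsum : Summable a := by
    refine summable_of_doubling (C := 2 * (N * 5 ^ d + 1)) (D := 2 * a 1) ha0 (by positivity)
      (by have := ha0 1; positivity) hw0 hw1 (fun n => ?_) fun n => ?_
    · nlinarith [hmulr n 1, mul_le_mul_of_nonneg_left (hab 1) (ha0 n),
        mul_le_mul_of_nonneg_right (hab n) (ha0 1)]
    · calc a (2 * n) ≤ a n * (2 * b n) := by rw [two_mul]; linarith [hmulr n n]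
        _ ≤ a n * (2 * ((N * 5 ^ d + 1) * w ^ n * (1 + a n))) := by
            have := ha0 n
            gcongr
            exact hbw n
        _ = _ := by ring
  convert! hsum.tsum_ofReal_ne_top using 3 with n
  exact (ENNReal.ofReal_toReal (hfin n).ne).symm

/-- Operators `z - T` with `‖T‖ < |z|` have an inverse whose matrix lies in the weighted Schur
class if the one of `T` does. -/
lemma IsRelativelySeparated.exists_inverse [CompleteSpace H] (hX : IsRelativelySeparated X) {p : ℝ}
    (hp0 : 0 < p) (hp1 : p ≤ 1) {ε : ℝ} (hε0 : 0 < ε) (hε1 : ε ≤ 1)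
    {T : lp (fun _ : X => H) 2 →L[ℂ] lp (fun _ : X => H) 2} {z : ℂ} (hz : ‖T‖ < ‖z‖)
    (hTS : opSchurNorm p (polyKernel ε) T < ∞) :
    ∃ S : lp (fun _ : X => H) 2 →L[ℂ] lp (fun _ : X => H) 2,
      opSchurNorm p (polyKernel ε) S < ∞ ∧ (z • 1 - T) * S = 1 ∧ S * (z • 1 - T) = 1 := by
  have hz0 : 0 < ‖z‖ := (norm_nonneg T).trans_lt hz
  have hzne : z ≠ 0 := norm_pos_iff.1 hz0
  have hfac : z • 1 - T = z • (1 - z⁻¹ • T) := by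
    rw [smul_sub, smul_inv_smul₀ hzne]
  have hlt : ‖z⁻¹ • T‖ < 1 := by
    rw [norm_smul, norm_inv, ← div_eq_inv_mul, div_lt_one hz0]
    exact hz
  have hfin : ∀ (c : ℂ) (R : lp (fun _ : X => H) 2 →L[ℂ] lp (fun _ : X => H) 2),
      opSchurNorm p (polyKernel ε) R < ∞ → opSchurNorm p (polyKernel ε) (c • R) < ∞ :=
    fun c R hR => (opSchurNorm_smul_le R hp0 c).trans_lt
      (ENNReal.mul_lt_top (ENNReal.rpow_lt_top_of_nonneg hp0.le enorm_ne_top) hR)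
  have hsum := summable_geometric_of_norm_lt_one hlt
  refine ⟨z⁻¹ • ∑' n : ℕ, (z⁻¹ • T) ^ n, hfin _ _ ?_, ?_, ?_⟩
  · exact (opSchurNorm_hasSum_le _ hp0 hp1 hsum.hasSum).trans_lt
      (hX.tsum_opSchurNorm_pow_ne_top hp0 hp1 hε0 hε1 hlt (hfin _ _ hTS)).lt_top
  · rw [hfac, smul_mul_smul_comm, mul_inv_cancel₀ hzne, one_smul, mul_neg_geom_series _ hlt]
  · rw [hfac, smul_mul_smul_comm, inv_mul_cancel₀ hzne, one_smul, geom_series_mul_neg _ hlt]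

end PolynomialWeight

/-! ### Comparison of spectra and radii. -/

section Spectrum

variable {d : ℕ} {X : Set (EuclideanSpace ℝ (Fin d))}
  {H : Type*} [NormedAddCommGroup H] [InnerProductSpace ℂ H]

lemma schurNorm_eq_kernelNorm {p : ℝ} (hp0 : 0 < p) (ν : EuclideanSpace ℝ (Fin d) → ℝ)
    (A : Matrix X X (H →L[ℂ] H)) :
    schurNorm p ν A = kernelNorm fun k l => ‖A k l‖ₑ ^ p * ENNReal.ofReal (ν (k - l) ^ p) := by
  have h : ∀ k l : X, ENNReal.ofReal (‖A k l‖ ^ p * ν (k - l) ^ p) =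
      ‖A k l‖ₑ ^ p * ENNReal.ofReal (ν (k - l) ^ p) := fun k l => by
    rw [ENNReal.ofReal_mul (by positivity), ← ENNReal.ofReal_rpow_of_nonneg (norm_nonneg _) hp0.le,
      ofReal_norm]
  simp only [schurNorm, kernelNorm, h]

/-- The `p`-th power turns the exponent `δ` into `δ * p`, which is at most 1 in the application, so
the kernel is subadditive. -/
lemma schurNorm_polyWeight_entry {p : ℝ} (hp0 : 0 < p) (δ : ℝ)
    (T : lp (fun _ : X => H) 2 →L[ℂ] lp (fun _ : X => H) 2) :
    schurNorm p (polyWeight δ) (entry T) = opSchurNorm p (polyKernel (δ * p)) T := by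
  rw [schurNorm_eq_kernelNorm hp0, opSchurNorm]
  congr! 5 with k l
  rw [polyKernel, polyWeight, polyWeight, Real.rpow_mul (by positivity)]

lemma schurNorm_one_eq {p : ℝ} (hp0 : 0 < p) (A : Matrix X X (H →L[ℂ] H)) :
    schurNorm p (fun _ => 1) A = kernelNorm fun k l => ‖A k l‖ₑ ^ p := by
  simp [schurNorm_eq_kernelNorm hp0]

lemma schurClass_polyWeight_subset {p : ℝ} (hp0 : 0 < p) {δ : ℝ} (hδ : 0 ≤ δ) :
    schurClass X H p (polyWeight δ) ⊆ schurClass X H p (fun _ => 1) := by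
  intro A hA
  refine lt_of_le_of_lt ?_ (show schurNorm p (polyWeight δ) A < ∞ from hA)
  rw [schurNorm_eq_kernelNorm hp0, schurNorm_eq_kernelNorm hp0]
  refine kernelNorm_mono fun k l => ?_
  gcongr
  exact one_le_polyWeight hδ _

lemma schurSpectrum_anti {p : ℝ} {ν ν' : EuclideanSpace ℝ (Fin d) → ℝ}
    (h : schurClass X H p ν' ⊆ schurClass X H p ν) (A : Matrix X X (H →L[ℂ] H)) :
    schurSpectrum p ν A ⊆ schurSpectrum p ν' A := by
  rintro z hz ⟨B, hB, hB'⟩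
  exact hz ⟨B, h hB, hB'⟩

lemma opSchurNorm_one_lt_top_of_mem {p : ℝ} (hp0 : 0 < p)
    {T : lp (fun _ : X => H) 2 →L[ℂ] lp (fun _ : X => H) 2}
    (hT : entry T ∈ schurClass X H p (fun _ => 1)) : opSchurNorm p 1 T < ∞ := by
  have h : schurNorm p (fun _ => 1) (entry T) < ∞ := hT
  simpa [opSchurNorm, schurNorm_one_eq hp0] using h

lemma entry_smul_one_sub [DecidableEq X] (z : ℂ) (T : lp (fun _ : X => H) 2 →L[ℂ] lp (fun _ : X => H) 2) :
    entry (z • 1 - T) = z • 1 - entry T := by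
  rw [entry_sub, entry_smul, entry_one]

lemma opSchurNorm_smul_one_sub_lt_top {p : ℝ} (hp0 : 0 < p) (hp1 : p ≤ 1) (z : ℂ)
    {T : lp (fun _ : X => H) 2 →L[ℂ] lp (fun _ : X => H) 2} (hT : opSchurNorm p 1 T < ∞) :
    opSchurNorm p 1 (z • 1 - T) < ∞ := by
  refine (opSchurNorm_sub_le _ _ hp0 hp1).trans_lt (ENNReal.add_lt_top.2 ⟨?_, hT⟩)
  refine (opSchurNorm_smul_le _ hp0 z).trans_lt (ENNReal.mul_lt_top
    (ENNReal.rpow_lt_top_of_nonneg hp0.le enorm_ne_top) ?_)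
  exact (opSchurNorm_one_le hp0 fun _ => le_rfl).trans_lt ENNReal.one_lt_top

lemma schurRadius_le_rpow {p : ℝ} (hp0 : 0 < p) {ν : EuclideanSpace ℝ (Fin d) → ℝ}
    {A : Matrix X X (H →L[ℂ] H)} {ρ : ℝ≥0∞} (h : ∀ z ∈ schurSpectrum p ν A, ‖z‖ₑ ≤ ρ) :
    schurRadius p ν A ≤ ρ ^ p := by
  refine iSup₂_le fun z hz => ?_
  rw [← ENNReal.ofReal_rpow_of_nonneg (norm_nonneg z) hp0.le, ofReal_norm]
  exact ENNReal.rpow_le_rpow (h z hz) hp0.le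

lemma spectralRadius_rpow_le_schurRadius {p : ℝ} (hp0 : 0 < p)
    {ν : EuclideanSpace ℝ (Fin d) → ℝ} {A : Matrix X X (H →L[ℂ] H)}
    {T : lp (fun _ : X => H) 2 →L[ℂ] lp (fun _ : X => H) 2}
    (h : spectrum ℂ T ⊆ schurSpectrum p ν A) : spectralRadius ℂ T ^ p ≤ schurRadius p ν A := by
  rw [← ENNReal.le_rpow_inv_iff hp0]
  refine iSup₂_le fun z hz => (ENNReal.le_rpow_inv_iff hp0).2 ?_
  rw [← enorm_eq_nnnorm, ← ofReal_norm, ENNReal.ofReal_rpow_of_nonneg (norm_nonneg z) hp0.le]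
  exact le_iSup₂ (f := fun z (_ : z ∈ schurSpectrum p ν A) => ENNReal.ofReal (‖z‖ ^ p)) z (h hz)

variable [CompleteSpace H]

lemma exists_entry_eq_of_mem_schurClass {p : ℝ} (hp0 : 0 < p) (hp1 : p ≤ 1)
    {A : Matrix X X (H →L[ℂ] H)} (hA : A ∈ schurClass X H p (fun _ => 1)) :
    ∃ T : lp (fun _ : X => H) 2 →L[ℂ] lp (fun _ : X => H) 2, entry T = A := by
  refine exists_entry_eq (kernelNorm_lt_top_of_rpow hp0 hp1 ?_)
  rw [← schurNorm_one_eq hp0]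
  exact hA

lemma matMul_entry {p : ℝ} (hp0 : 0 < p) (hp1 : p ≤ 1)
    {S : lp (fun _ : X => H) 2 →L[ℂ] lp (fun _ : X => H) 2} (hS : opSchurNorm p 1 S < ∞)
    (T : lp (fun _ : X => H) 2 →L[ℂ] lp (fun _ : X => H) 2) :
    matMul (entry S) (entry T) = entry (S * T) := by
  ext1 k l
  refine (hasSum_entry_mul S T (ne_top_of_le_ne_top (kernelNorm_lt_top_of_rpow hp0 hp1 ?_).ne
    (row_le_kernelNorm (fun k l => ‖entry S k l‖ₑ) k)) l).tsum_eq
  simpa [opSchurNorm] using hS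

/-- By Schur's test an inverse in `S^p` is a bounded operator, and matrix products of such matrices
are operator products. -/
lemma spectrum_subset_schurSpectrum {p : ℝ} (hp0 : 0 < p) (hp1 : p ≤ 1)
    {T : lp (fun _ : X => H) 2 →L[ℂ] lp (fun _ : X => H) 2}
    (hT : entry T ∈ schurClass X H p (fun _ => 1)) :
    spectrum ℂ T ⊆ schurSpectrum p (fun _ => 1) (entry T) := by
  classical
  rintro z hz ⟨B, hB, hright, hleft⟩
  obtain ⟨S, rfl⟩ := exists_entry_eq_of_mem_schurClass hp0 hp1 hB
  have hTfin := opSchurNorm_smul_one_sub_lt_top hp0 hp1 z (opSchurNorm_one_lt_top_of_mem hp0 hT)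
  rw [← entry_smul_one_sub, matMul_entry hp0 hp1 hTfin, ← entry_one] at hright
  rw [← entry_smul_one_sub, matMul_entry hp0 hp1 (opSchurNorm_one_lt_top_of_mem hp0 hB),
    ← entry_one] at hleft
  refine hz ?_
  rw [spectrum.mem_resolventSet_iff, Algebra.algebraMap_eq_smul_one]
  exact ⟨⟨_, S, entry_injective hright, entry_injective hleft⟩, rfl⟩

/-- No self-adjointness is involved here; the bound is by the norm, not yet by the spectral radius.
-/
lemma norm_le_of_mem_schurSpectrum (hX : IsRelativelySeparated X) {p : ℝ} (hp0 : 0 < p)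
    (hp1 : p ≤ 1) {δ : ℝ} (hδ0 : 0 < δ) (hδ1 : δ ≤ 1)
    {T : lp (fun _ : X => H) 2 →L[ℂ] lp (fun _ : X => H) 2}
    (hT : entry T ∈ schurClass X H p (polyWeight δ)) {z : ℂ}
    (hz : z ∈ schurSpectrum p (polyWeight δ) (entry T)) : ‖z‖ ≤ ‖T‖ := by
  classical
  by_contra! hlt
  have hTfin : opSchurNorm p (polyKernel (δ * p)) T < ∞ := by
    rw [← schurNorm_polyWeight_entry hp0]
    exact hT
  obtain ⟨S, hS, hright, hleft⟩ := hX.exists_inverse hp0 hp1 (mul_pos hδ0 hp0)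
    (mul_le_one₀ hδ1 hp0.le hp1) hlt hTfin
  rw [← schurNorm_polyWeight_entry hp0] at hS
  refine hz ⟨entry S, hS, ?_, ?_⟩
  · rw [← entry_smul_one_sub, matMul_entry hp0 hp1 (opSchurNorm_smul_one_sub_lt_top hp0 hp1 z
      (opSchurNorm_one_lt_top_of_mem hp0 (schurClass_polyWeight_subset hp0 hδ0.le hT))), hright,
      entry_one]
  · rw [← entry_smul_one_sub, matMul_entry hp0 hp1
      (opSchurNorm_one_lt_top_of_mem hp0 (schurClass_polyWeight_subset hp0 hδ0.le hS)), hleft,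
      entry_one]

end Spectrum

end SchurAlg

theorem theorem3p5 {d : ℕ} (X : Set (EuclideanSpace ℝ (Fin d)))
    (hX : SchurAlg.IsRelativelySeparated X)
    {H : Type*} [NormedAddCommGroup H] [InnerProductSpace ℂ H] [CompleteSpace H]
    (p : ℝ) (hp0 : 0 < p) (hp1 : p ≤ 1) (δ : ℝ) (hδ0 : 0 < δ) (hδ1 : δ ≤ 1)
    (A : Matrix X X (H →L[ℂ] H))
    (hA : A ∈ SchurAlg.schurClass X H p (SchurAlg.polyWeight δ))
    (hsa : A.IsHermitian) :
    ∃ T : lp (fun _ : X => H) 2 →L[ℂ] lp (fun _ : X => H) 2,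
      SchurAlg.IsOperatorOf T A ∧
      SchurAlg.schurRadius p (SchurAlg.polyWeight δ) A
        = SchurAlg.schurRadius p (fun _ => 1) A ∧
      SchurAlg.schurRadius p (fun _ => 1) A = (spectralRadius ℂ T) ^ p := by
  have hsub := SchurAlg.schurClass_polyWeight_subset (X := X) (H := H) hp0 hδ0.le
  obtain ⟨T, rfl⟩ := SchurAlg.exists_entry_eq_of_mem_schurClass hp0 hp1 (hsub hA)
  have hT : IsSelfAdjoint T :=
    SchurAlg.entry_injective ((SchurAlg.entry_adjoint T).trans hsa)
  have h1 := SchurAlg.spectralRadius_rpow_le_schurRadius hp0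
    (SchurAlg.spectrum_subset_schurSpectrum hp0 hp1 (hsub hA))
  have h2 : SchurAlg.schurRadius p (fun _ => 1) (SchurAlg.entry T) ≤
      SchurAlg.schurRadius p (SchurAlg.polyWeight δ) (SchurAlg.entry T) :=
    biSup_mono fun z hz => SchurAlg.schurSpectrum_anti hsub _ hz
  have h3 : SchurAlg.schurRadius p (SchurAlg.polyWeight δ) (SchurAlg.entry T) ≤
      spectralRadius ℂ T ^ p := by
    refine SchurAlg.schurRadius_le_rpow hp0 fun z hz => ?_
    -- Self-adjointness enters here, through the equality of norm and spectral radius in a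
    -- C*-algebra.
    rw [hT.spectralRadius_eq_nnnorm, ← enorm_eq_nnnorm]
    exact enorm_le_iff_norm_le.2
      (SchurAlg.norm_le_of_mem_schurSpectrum hX hp0 hp1 hδ0 hδ1 hA hz)
  exact ⟨T, SchurAlg.hasSum_entry T, le_antisymm (h3.trans h1) h2, le_antisymm (h2.trans h3) h1⟩
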